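/- Let $\mathbb{K}$ be $\mathbb{R}$ or $\mathbb{C}$. All locally convex spaces are over $\mathbb{K}$ and are assumed $T_0$ (equivalently, Hausdorff); Banach spaces are regarded as locally convex spaces. **Definitions.** A locally convex space $E$ is *barreled* if every closed, absolutely convex, absorbing subset of $E$ is a $0$-neighborhood (equivalently, every lower semicontinuous seminorm on $E$ is continuous). It is a *Pták space* if a linear subspace $Q$ of the dual $E'$ is $\sigma(E',E)$-closed whenever $Q\cap A$ is $\sigma(E',E)$-closed in $A$ for every equicontinuous set $A\subseteq E'$. A linear map $u\colon E\to F$ is *nearly open* if for each $0$-neighborhood $U\subseteq E$ the image $u(U)$ is dense in some $0$-neighborhood of $u(E)$. For a class $\mathcal{C}$ of locally convex spaces consider the properties: - (O) for all $E,F\in\mathcal{C}$, every surjective, linear, continuous map $u\colon E\to F$ is open; - (C) for all $E,F\in\mathcal{C}$, every bijective, linear map $u\colon E\to F$ is continuous if and only if $u^{-1}$ is continuous; - (G) for all $E,F\in\mathcal{C}$, every linear map $u\colon E\to F$ has closed graph in $E\times F$ if and only if it is continuous. Call $\mathcal{C}$ *admissible* if 1. $\mathcal{C}$ contains all Banach spaces;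 2. for every $E\in\mathcal{C}$ and every closed linear subspace $N$ of $E$, the quotient $E/N$ is in $\mathcal{C}$; 3. for all $E,F\in\mathcal{C}$ and every linear map $u\colon E\to F$ with closed graph, the graph of $u$ (as a subspace of $E\times F$) is in $\mathcal{C}$; 4. for every $E\in\mathcal{C}$, every locally convex space $F$ and every injective, linear, continuous, nearly open map $u\colon E\to F$, the image $u(E)$ (as a subspace of $F$) is in $\mathcal{C}$; 5. $\mathcal{C}$ satisfies at least one of (O), (C), (G). **Theorem (Barreled Pták Characterization).** The class of barreled Pták spaces is the largest admissible class: it is admissible, and every admissible class is contained in it. Moreover, every admissible class satisfies all three of (O), (C) and (G). -/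

import Mathlib

open Topology

universe u v

/-- A Hausdorff locally convex space over `𝕜` (`= ℝ` or `ℂ`), bundled. For a topological vector
space, `T₀` and `T₂` are equivalent. The real structure is the restriction of scalars (it is
uniquely determined by `IsScalarTower`), and local convexity refers to it. -/
structure LCS (𝕜 : Type v) [RCLike 𝕜] : Type (max v (u + 1)) where
  carrier : Type u
  [addCommGroup : AddCommGroup carrier]
  [module : Module 𝕜 carrier]
  [moduleReal : Module ℝ carrier]
  [isScalarTower : IsScalarTower ℝ 𝕜 carrier]
  [topologicalSpace : TopologicalSpace carrier]
  [isTopologicalAddGroup : IsTopologicalAddGroup carrier]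
  [continuousSMul : ContinuousSMul 𝕜 carrier]
  [locallyConvexSpace : LocallyConvexSpace ℝ carrier]
  [t0Space : T0Space carrier]

namespace LCS

variable {𝕜 : Type v} [RCLike 𝕜]

instance : CoeSort (LCS.{u, v} 𝕜) (Type u) := ⟨LCS.carrier⟩

attribute [instance] addCommGroup module moduleReal isScalarTower topologicalSpace
  isTopologicalAddGroup continuousSMul locallyConvexSpace t0Space

/-- A subspace of a locally convex space, with the subspace topology, is locally convex. -/
theorem locallyConvexSpace_submodule {E : Type u} [AddCommGroup E] [Module 𝕜 E] [Module ℝ E]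
    [IsScalarTower ℝ 𝕜 E] [TopologicalSpace E] [LocallyConvexSpace ℝ E] (S : Submodule 𝕜 E) :
    LocallyConvexSpace ℝ S :=
  Topology.IsInducing.locallyConvexSpace (f := S.subtype.restrictScalars ℝ) .subtypeVal

/-- A quotient of a locally convex space, with the quotient topology, is locally convex. -/
theorem locallyConvexSpace_quotient {E : Type u} [AddCommGroup E] [Module 𝕜 E] [Module ℝ E]
    [IsScalarTower ℝ 𝕜 E] [TopologicalSpace E] [IsTopologicalAddGroup E]
    [LocallyConvexSpace ℝ E] (S : Submodule 𝕜 E) : LocallyConvexSpace ℝ (E ⧸ S) := by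
  rw [locallyConvexSpace_iff_exists_convex_subset_zero]
  intro U hU
  have hc : Filter.Tendsto S.mkQ (𝓝 0) (𝓝 0) := by
    simpa using S.isOpenQuotientMap_mkQ.continuous.tendsto 0
  obtain ⟨V, hV, hVc, hVU⟩ :=
    (locallyConvexSpace_iff_exists_convex_subset_zero ℝ E).1 inferInstance _ (hc hU)
  refine ⟨S.mkQ '' V, ?_, ?_, Set.image_subset_iff.2 hVU⟩
  · simpa using S.isOpenMap_mkQ.image_mem_nhds hV
  · exact hVc.linear_image (S.mkQ.restrictScalars ℝ)

/-- A linear subspace of a locally convex space, with the subspace topology. -/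
def sub (E : LCS.{u, v} 𝕜) (S : Submodule 𝕜 E) : LCS.{u, v} 𝕜 :=
  haveI := locallyConvexSpace_submodule S
  { carrier := S }

/-- The quotient of a locally convex space by a closed linear subspace, with the quotient
topology. -/
def quot (E : LCS.{u, v} 𝕜) (N : Submodule 𝕜 E) (hN : IsClosed (N : Set E)) : LCS.{u, v} 𝕜 :=
  haveI := locallyConvexSpace_quotient N
  haveI : IsClosed (N : Set E) := hN
  { carrier := E ⧸ N }

/-- The product of two locally convex spaces, with the product topology. -/
def prod (E F : LCS.{u, v} 𝕜) : LCS.{u, v} 𝕜 where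
  carrier := E × F

/-- The graph of a linear map, as a subspace of the product. -/
def graph {E F : LCS.{u, v} 𝕜} (f : E →ₗ[𝕜] F) : LCS.{u, v} 𝕜 :=
  (E.prod F).sub f.graph

/-- A normed space over `𝕜`, as a locally convex space. -/
noncomputable def ofNormed (B : Type u) [NormedAddCommGroup B] [NormedSpace 𝕜 B] : LCS.{u, v} 𝕜 :=
  letI : NormedSpace ℝ B := NormedSpace.restrictScalars ℝ 𝕜 B
  haveI : IsScalarTower ℝ 𝕜 B := IsScalarTower.restrictScalars ℝ 𝕜 B
  { carrier := B }

/-- A linear map is nearly open if the image of each `0`-neighbourhood `U` is dense in some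
`0`-neighbourhood `V` of the image space. -/
def NearlyOpen {E F : LCS.{u, v} 𝕜} (f : E →ₗ[𝕜] F) : Prop :=
  ∀ U ∈ 𝓝 (0 : E), ∃ V ∈ 𝓝 (0 : LinearMap.range f),
    f.rangeRestrict '' U ⊆ V ∧ V ⊆ closure (f.rangeRestrict '' U)

/-- `E` is a Pták space (`B`-complete): a subspace `Q` of the dual is weak-* closed as soon as
`Q ∩ A` is weak-* closed in `A` for every equicontinuous set `A`. -/
def IsPtak (E : LCS.{u, v} 𝕜) : Prop :=
  ∀ Q : Submodule 𝕜 (WeakDual 𝕜 E),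
    (∀ A : Set (WeakDual 𝕜 E), Set.Equicontinuous ((fun f : WeakDual 𝕜 E ↦ (f : E → 𝕜)) '' A) →
      IsClosed ((Subtype.val : A → WeakDual 𝕜 E) ⁻¹' (Q : Set (WeakDual 𝕜 E)))) →
    IsClosed (Q : Set (WeakDual 𝕜 E))

/-- The class of barreled Pták spaces. -/
def barreledPtak (𝕜 : Type v) [RCLike 𝕜] : Set (LCS.{u, v} 𝕜) :=
  {E | BarrelledSpace 𝕜 E ∧ E.IsPtak}

/-! Properties of a class `C` of locally convex spaces. -/

/-- (O) -/
def OpenMappingProperty (C : Set (LCS.{u, v} 𝕜)) : Prop :=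
  ∀ E ∈ C, ∀ F ∈ C, ∀ f : E →ₗ[𝕜] F, Function.Surjective f → Continuous f → IsOpenMap f

/-- (C) -/
def ContinuousInverseProperty (C : Set (LCS.{u, v} 𝕜)) : Prop :=
  ∀ E ∈ C, ∀ F ∈ C, ∀ f : E ≃ₗ[𝕜] F, Continuous f ↔ Continuous f.symm

/-- (G) -/
def ClosedGraphProperty (C : Set (LCS.{u, v} 𝕜)) : Prop :=
  ∀ E ∈ C, ∀ F ∈ C, ∀ f : E →ₗ[𝕜] F, IsClosed (f.graph : Set (E × F)) ↔ Continuous f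

def ContainsBanachSpaces (C : Set (LCS.{u, v} 𝕜)) : Prop :=
  ∀ (B : Type u) [NormedAddCommGroup B] [NormedSpace 𝕜 B] [CompleteSpace B], ofNormed B ∈ C

def ClosedUnderQuotients (C : Set (LCS.{u, v} 𝕜)) : Prop :=
  ∀ E ∈ C, ∀ (N : Submodule 𝕜 E) (hN : IsClosed (N : Set E)), E.quot N hN ∈ C

def ClosedUnderClosedGraphs (C : Set (LCS.{u, v} 𝕜)) : Prop :=
  ∀ E ∈ C, ∀ F ∈ C, ∀ f : E →ₗ[𝕜] F, IsClosed (f.graph : Set (E × F)) → graph f ∈ C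

/-- The target `F` is an arbitrary locally convex space, not necessarily in `C`. -/
def ClosedUnderContinuousImages (C : Set (LCS.{u, v} 𝕜)) : Prop :=
  ∀ E ∈ C, ∀ (F : LCS.{u, v} 𝕜) (f : E →ₗ[𝕜] F), Function.Injective f → Continuous f →
    NearlyOpen f → F.sub (LinearMap.range f) ∈ C

/-- The properties in the characterization: the closure properties, and one of (O), (C), (G). -/
structure Admissible (C : Set (LCS.{u, v} 𝕜)) : Prop where
  banach : ContainsBanachSpaces C
  quotients : ClosedUnderQuotients C
  graphs : ClosedUnderClosedGraphs C
  images : ClosedUnderContinuousImages C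
  openInverseOrGraph :
    OpenMappingProperty C ∨ ContinuousInverseProperty C ∨ ClosedGraphProperty C

end LCS

/-! For a subspace `Q` of the dual and a continuous seminorm `q`, let `p_q = supSeminorm Q q` be the
supremum of `|g|` over the `g ∈ Q` dominated by `q`. If `Q` is nearly closed, Hahn–Banach gives two
facts: a functional dominated by `p_q` lies in `Q` (`NearlyClosed.mem_of_norm_le`), and the infimal
convolution of `q` with any `p_q'` is at most `p_q` (`NearlyClosed.inf_supSeminorm_le`). Thus a
vector with `p_q < 1` splits into a part with `q < 1` and a remainder that is small for any
prescribed `p_q'`.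

Admissibility of the barreled Pták spaces: for `f : E → F` with closed graph, the functionals with
continuous pullback along `f` form a subspace that is nearly closed because `E` is barrelled, and
total because the graph is closed. The Pták property makes it the whole dual, so (G) holds. Banach
spaces are Pták by iterating the splitting (Krein–Šmulian).

Maximality: (O) implies (C), and (C) implies (G) by projecting the graph onto the domain. Applying
(G) to the Banach completion of a lower semicontinuous seminorm gives barrelledness. For the Pták
property, pass to the quotient by the common kernel of `Q` and retopologize it by the seminorms
`p_q`. The dual becomes `Q`, and the identity is continuous and nearly open by the splitting, so (C)
makes it an isomorphism and `Q` is the full annihilator of the kernel. -/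

namespace PtakSpace

/-! ### Hahn–Banach for seminorms -/

section Seminorms

variable {𝕜 : Type*} [RCLike 𝕜] {E : Type*} [AddCommGroup E] [Module 𝕜 E]

open scoped ComplexOrder in
theorem polynormableSpace_of_locallyConvexSpace_real [Module ℝ E] [IsScalarTower ℝ 𝕜 E]
    [TopologicalSpace E] [IsTopologicalAddGroup E] [ContinuousSMul 𝕜 E]
    [LocallyConvexSpace ℝ E] : PolynormableSpace 𝕜 E := by
  have := IsScalarTower.continuousSMul (M := ℝ) (α := E) 𝕜
  have : LocallyConvexSpace 𝕜 E := by
    rw [locallyConvexSpace_iff_exists_convex_subset_zero]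
    intro U hU
    obtain ⟨V, hV, hc, hVU⟩ :=
      (locallyConvexSpace_iff_exists_convex_subset_zero ℝ E).1 inferInstance U hU
    exact ⟨V, hV, convex_RCLike_iff_convex_real.2 hc, hVU⟩
  infer_instance

/-- A seminorm is attained at each point by a functional that it dominates. -/
theorem exists_dual_le_seminorm_apply_eq (p : Seminorm 𝕜 E) (x : E) :
    ∃ f : Module.Dual 𝕜 E, (∀ y, ‖f y‖ ≤ p y) ∧ ‖f x‖ = p x := by
  by_cases hx : x = 0
  · exact ⟨0, by simp, by simp [hx]⟩
  let e := LinearEquiv.toSpanNonzeroSingleton 𝕜 E x hx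
  let g : Module.Dual 𝕜 (𝕜 ∙ x) := (p x : 𝕜) • e.symm.toLinearMap
  have hg : ∀ y, ‖g y‖ ≤ p y := by
    intro y
    obtain ⟨c, rfl⟩ := e.surjective y
    have : ((e c : 𝕜 ∙ x) : E) = c • x := rfl
    simp [g, this, map_smul_eq_mul, norm_smul, abs_of_nonneg (apply_nonneg p x), mul_comm]
  obtain ⟨f, hf, hfp⟩ := g.exists_extension_of_le_seminorm _ hg
  refine ⟨f, hfp, ?_⟩
  have h := hf (e 1)
  have h1 : ((e 1 : 𝕜 ∙ x) : E) = x := one_smul _ _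
  rw [h1] at h
  simp [h, g, abs_of_nonneg (apply_nonneg p x)]

end Seminorms

/-! ### The weak-* dual as a locally convex space -/

section WeakDual

variable {𝕜 : Type*} [RCLike 𝕜] {E : Type*} [AddCommGroup E] [Module 𝕜 E] [TopologicalSpace E]

instance weakDual_isScalarTower_real : IsScalarTower ℝ 𝕜 (WeakDual 𝕜 E) :=
  ⟨fun a b f => DFunLike.ext _ _ fun x => smul_assoc a b (f x)⟩

instance weakDual_locallyConvexSpace : LocallyConvexSpace ℝ (WeakDual 𝕜 E) := by
  let φ : WeakDual 𝕜 E →ₗ[ℝ] (E → 𝕜) :=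
    { toFun := fun f => f, map_add' := fun _ _ => rfl, map_smul' := fun _ _ => rfl }
  exact Topology.IsInducing.locallyConvexSpace (f := φ) ⟨rfl⟩

theorem exists_eq_eval_of_continuous_linear (φ : WeakDual 𝕜 E → 𝕜) (hφ : IsLinearMap 𝕜 φ)
    (hc : Continuous φ) : ∃ x : E, ∀ f : WeakDual 𝕜 E, φ f = f x := by
  obtain ⟨x, hx⟩ := LinearMap.dualEmbedding_surjective (topDualPairing 𝕜 E)
    { hφ.mk' φ with cont := hc }
  exact ⟨x, fun f => (DFunLike.congr_fun hx f).symm⟩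

end WeakDual

/-! ### Nearly closed subspaces and their seminorms -/

section NearlyClosed

variable {𝕜 : Type*} [RCLike 𝕜] {E : Type*} [AddCommGroup E] [Module 𝕜 E] [TopologicalSpace E]

/-- The members of a subspace of the dual that are dominated by a seminorm. -/
def dominated (Q : Submodule 𝕜 (WeakDual 𝕜 E)) (q : Seminorm 𝕜 E) : Set (WeakDual 𝕜 E) :=
  {f | f ∈ Q ∧ ∀ x, ‖f x‖ ≤ q x}

/-- A subspace of the dual whose traces on the polars of neighbourhoods of zero are weak-* closed,
expressed with continuous seminorms. -/
def NearlyClosed (Q : Submodule 𝕜 (WeakDual 𝕜 E)) : Prop :=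
  ∀ q : Seminorm 𝕜 E, Continuous q → IsClosed (dominated Q q)

theorem isClosed_setOf_norm_le (p : E → ℝ) : IsClosed {f : WeakDual 𝕜 E | ∀ x, ‖f x‖ ≤ p x} := by
  simp only [Set.ofPred_forall]
  exact isClosed_iInter fun x =>
    isClosed_le (WeakDual.eval_continuous x).norm continuous_const

theorem convex_dominated (Q : Submodule 𝕜 (WeakDual 𝕜 E)) (q : Seminorm 𝕜 E) :
    Convex ℝ (dominated Q q) := by
  rintro f ⟨hf, hfq⟩ g ⟨hg, hgq⟩ a b ha hb hab
  have h : ∀ (c : ℝ) (k : WeakDual 𝕜 E), c • k = (c : 𝕜) • k := fun c k =>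
    (RCLike.real_smul_eq_coe_smul (K := 𝕜) c k)
  refine ⟨?_, fun x => ?_⟩
  · rw [h, h]
    exact Q.add_mem (Q.smul_mem _ hf) (Q.smul_mem _ hg)
  · calc ‖a • f x + b • g x‖ ≤ a * ‖f x‖ + b * ‖g x‖ := by
          refine (norm_add_le _ _).trans_eq ?_
          rw [norm_smul, norm_smul, Real.norm_of_nonneg ha, Real.norm_of_nonneg hb]
      _ ≤ a * q x + b * q x := by gcongr <;> [exact hfq x; exact hgq x]
      _ = q x := by rw [← add_mul, hab, one_mul]

/-- The seminorm of uniform convergence on the members of `Q` dominated by `q`. -/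
noncomputable def supSeminorm (Q : Submodule 𝕜 (WeakDual 𝕜 E)) (q : Seminorm 𝕜 E) :
    Seminorm 𝕜 E :=
  ⨆ f : dominated Q q, (WeakDual.toStrongDual (f : WeakDual 𝕜 E)).toLinearMap.toSeminorm

variable {Q : Submodule 𝕜 (WeakDual 𝕜 E)} {q : Seminorm 𝕜 E}

instance : Nonempty (dominated Q q) := ⟨⟨0, Q.zero_mem, fun x => by
  change ‖(0 : 𝕜)‖ ≤ _; simp⟩⟩

theorem bddAbove_dominated (Q : Submodule 𝕜 (WeakDual 𝕜 E)) (q : Seminorm 𝕜 E) :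
    BddAbove (Set.range fun f : dominated Q q =>
      (WeakDual.toStrongDual (f : WeakDual 𝕜 E)).toLinearMap.toSeminorm) :=
  ⟨q, by rintro _ ⟨f, rfl⟩ x; exact f.2.2 x⟩

theorem norm_le_supSeminorm {f : WeakDual 𝕜 E} (hf : f ∈ dominated Q q) (x : E) :
    ‖f x‖ ≤ supSeminorm Q q x :=
  le_ciSup (bddAbove_dominated Q q) ⟨f, hf⟩ x

theorem supSeminorm_apply_le {x : E} {c : ℝ} (h : ∀ f ∈ dominated Q q, ‖f x‖ ≤ c) :
    supSeminorm Q q x ≤ c := by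
  rw [supSeminorm, Seminorm.iSup_apply (bddAbove_dominated Q q)]
  exact ciSup_le fun f => h f f.2

theorem supSeminorm_le : supSeminorm Q q ≤ q := fun x => supSeminorm_apply_le fun _ hf => hf.2 x

theorem supSeminorm_mono {q' : Seminorm 𝕜 E} (h : q ≤ q') : supSeminorm Q q ≤ supSeminorm Q q' :=
  fun x => supSeminorm_apply_le fun _ hf =>
    norm_le_supSeminorm ⟨hf.1, fun y => (hf.2 y).trans (h y)⟩ x

theorem mul_supSeminorm_le (c : NNReal) (x : E) :
    c * supSeminorm Q q x ≤ supSeminorm Q (c • q) x := by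
  rcases eq_or_ne c 0 with rfl | hc
  · simp
  have hc' : (0 : ℝ) < c := by positivity
  rw [← le_div_iff₀' hc']
  refine supSeminorm_apply_le fun f hf => ?_
  rw [le_div_iff₀' hc']
  have := norm_le_supSeminorm (Q := Q) (q := c • q) (f := ((c : ℝ) : 𝕜) • f)
    ⟨Q.smul_mem _ hf.1, fun y => ?_⟩ x
  · refine le_trans (le_of_eq ?_) this
    change _ = ‖((c : ℝ) : 𝕜) • f x‖
    simp
  · change ‖((c : ℝ) : 𝕜) • f y‖ ≤ (c : ℝ) * q y
    simp only [norm_smul, RCLike.norm_ofReal, abs_of_pos hc']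
    gcongr
    exact hf.2 y

theorem weakDual_smul_apply (c : 𝕜) (g : WeakDual 𝕜 E) (x : E) : (c • g) x = c * g x := rfl

theorem weakDual_zero_apply (x : E) : (0 : WeakDual 𝕜 E) x = 0 := rfl

theorem exists_isLinearMap_re_lt {F : Type*} [AddCommGroup F] [Module 𝕜 F] [Module ℝ F]
    [IsScalarTower ℝ 𝕜 F] [TopologicalSpace F] [IsTopologicalAddGroup F] [ContinuousSMul 𝕜 F]
    [LocallyConvexSpace ℝ F] {A : Set F} (hA : Convex ℝ A) (hAc : IsClosed A) {f : F}
    (hf : f ∉ A) : ∃ (φ : F → 𝕜) (u : ℝ), IsLinearMap 𝕜 φ ∧ Continuous φ ∧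
      (∀ a ∈ A, RCLike.re (φ a) < u) ∧ u < RCLike.re (φ f) := by
  obtain ⟨φ, u, h⟩ := RCLike.geometric_hahn_banach_closed_point (𝕜 := 𝕜) hA hAc hf
  exact ⟨φ, u, φ.toLinearMap.isLinear, φ.continuous, h⟩

/-- Points outside a closed real-convex set in the dual are separated from it by a vector. -/
theorem exists_re_apply_lt {A : Set (WeakDual 𝕜 E)} (hA : Convex ℝ A) (hAc : IsClosed A)
    {f : WeakDual 𝕜 E} (hf : f ∉ A) :
    ∃ (x : E) (u : ℝ), (∀ g ∈ A, RCLike.re (g x) < u) ∧ u < RCLike.re (f x) := by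
  have h1 : ContinuousSMul 𝕜 (WeakDual 𝕜 E) := inferInstance
  have h2 : IsTopologicalAddGroup (WeakDual 𝕜 E) := inferInstance
  have h3 := @exists_isLinearMap_re_lt 𝕜 _ (WeakDual 𝕜 E) _ _ _ _ _ h2 h1
  have h4 := @h3 inferInstance
  obtain ⟨φ, u, hl, hc, hφ, hu⟩ := h4 hA hAc hf
  obtain ⟨x, hx⟩ := exists_eq_eval_of_continuous_linear φ ⟨hl.1, hl.2⟩ hc
  refine ⟨x, u, fun g hg => ?_, ?_⟩
  · rw [← hx]
    exact hφ g hg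
  · rw [← hx]
    exact hu

/-- A functional dominated by the supremum of the `q`-dominated members of a nearly closed
subspace is a member. -/
theorem NearlyClosed.mem_of_norm_le (hQ : NearlyClosed Q) (hq : Continuous q) {f : WeakDual 𝕜 E}
    (hf : ∀ x, ‖f x‖ ≤ supSeminorm Q q x) : f ∈ Q := by
  suffices f ∈ dominated Q q from this.1
  by_contra hfA
  obtain ⟨x, u, hx, hu⟩ := exists_re_apply_lt (convex_dominated Q q) (hQ q hq) hfA
  have h : supSeminorm Q q x ≤ u := by
    refine supSeminorm_apply_le fun g hg => ?_
    -- The dominated set is stable under unimodular scalars, so the bound on real parts is a bound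
    -- on norms.
    obtain ⟨c, hc, hcg⟩ : ∃ c : 𝕜, ‖c‖ = 1 ∧ ‖g x‖ = c * g x := RCLike.exists_norm_eq_mul_self _
    have hmem : c • g ∈ dominated Q q := by
      refine ⟨Q.smul_mem _ hg.1, fun y => ?_⟩
      rw [weakDual_smul_apply, norm_mul, hc, one_mul]
      exact hg.2 y
    have := hx _ hmem
    rw [weakDual_smul_apply, ← hcg, RCLike.ofReal_re] at this
    exact this.le
  have h1 := (RCLike.re_le_norm (f x)).trans (hf x)
  linarith

theorem continuous_of_norm_le [IsTopologicalAddGroup E] {f : Module.Dual 𝕜 E}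
    (hq : Continuous q) (hf : ∀ x, ‖f x‖ ≤ q x) : Continuous f := by
  refine continuous_of_continuousAt_zero f ?_
  rw [ContinuousAt, map_zero]
  refine squeeze_zero_norm hf ?_
  simpa using hq.tendsto 0

/-- The infimum `q ⊓ supSeminorm Q q'` is an infimal convolution. A functional that attains it at
`x` and is dominated by it lies below both seminorms: the second puts it in `Q`, the first among the
functionals defining `supSeminorm Q q`. -/
theorem NearlyClosed.inf_supSeminorm_le [IsTopologicalAddGroup E] (hQ : NearlyClosed Q)
    (hq : Continuous q) {q' : Seminorm 𝕜 E} (hq' : Continuous q') :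
    q ⊓ supSeminorm Q q' ≤ supSeminorm Q q := by
  intro x
  obtain ⟨f, hf, hfx⟩ := exists_dual_le_seminorm_apply_eq (q ⊓ supSeminorm Q q') x
  have hfq : ∀ y, ‖f y‖ ≤ q y := fun y => (hf y).trans ((inf_le_left : _ ≤ q) y)
  let g : WeakDual 𝕜 E := StrongDual.toWeakDual ⟨f, continuous_of_norm_le hq hfq⟩
  have hg : g ∈ Q := hQ.mem_of_norm_le hq' fun y =>
    (hf y).trans ((inf_le_right : _ ≤ supSeminorm Q q') y)
  rw [← hfx]
  exact norm_le_supSeminorm (f := g) ⟨hg, hfq⟩ x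

theorem exists_ne_zero_of_notMem (hQ : IsClosed (Q : Set (WeakDual 𝕜 E))) {f : WeakDual 𝕜 E}
    (hf : f ∉ Q) : ∃ x, (∀ g ∈ Q, g x = 0) ∧ f x ≠ 0 := by
  obtain ⟨x, u, hx, hu⟩ := exists_re_apply_lt (Q.restrictScalars ℝ).convex hQ hf
  have h0 : 0 < u := by simpa [weakDual_zero_apply] using hx 0 Q.zero_mem
  refine ⟨x, fun g hg => ?_, fun h => ?_⟩
  · by_contra hgx
    have := hx (((u : 𝕜) / g x) • g) (Q.smul_mem _ hg)
    rw [weakDual_smul_apply, div_mul_cancel₀ _ hgx, RCLike.ofReal_re] at this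
    exact this.false
  · rw [h, map_zero] at hu
    exact h0.not_gt hu

theorem isClosed_of_forall_mem
    (h : ∀ f : WeakDual 𝕜 E, (∀ x, (∀ g ∈ Q, g x = 0) → f x = 0) → f ∈ Q) :
    IsClosed (Q : Set (WeakDual 𝕜 E)) := by
  have : (Q : Set (WeakDual 𝕜 E)) = {f | ∀ x, (∀ g ∈ Q, g x = 0) → f x = 0} :=
    Set.Subset.antisymm (fun f hf x hx => hx f hf) h
  rw [this]
  simp only [Set.ofPred_forall]
  exact isClosed_iInter fun x => isClosed_iInter fun _ =>
    isClosed_eq (WeakDual.eval_continuous x) continuous_const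

end NearlyClosed

variable {𝕜 : Type*} [RCLike 𝕜]

/-! ### The Pták property, transposes and quotients -/

section Duality

variable {E F : Type*} [AddCommGroup E] [Module 𝕜 E] [TopologicalSpace E]
  [AddCommGroup F] [Module 𝕜 F] [TopologicalSpace F]

variable (𝕜 E) in
/-- The Pták property, expressed with continuous seminorms. -/
def HasPtakProperty : Prop :=
  ∀ Q : Submodule 𝕜 (WeakDual 𝕜 E), NearlyClosed Q → IsClosed (Q : Set (WeakDual 𝕜 E))

theorem equicontinuous_dominated_top [IsTopologicalAddGroup E] {q : Seminorm 𝕜 E}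
    (hq : Continuous q) :
    ((fun f : WeakDual 𝕜 E => (f : E → 𝕜)) '' dominated ⊤ q).Equicontinuous := by
  intro x₀
  refine Metric.equicontinuousAt_of_continuity_modulus (fun x => q (x₀ - x)) ?_ _ ?_
  · have : Continuous fun x => q (x₀ - x) := hq.comp (continuous_const.sub continuous_id)
    simpa using this.tendsto x₀
  · refine Filter.Eventually.of_forall ?_
    rintro x ⟨_, f, hf, rfl⟩
    rw [dist_eq_norm, ← map_sub]
    exact hf.2 _

theorem exists_subset_dominated_top [IsTopologicalAddGroup E] [ContinuousSMul 𝕜 E]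
    {A : Set (WeakDual 𝕜 E)}
    (hA : ((fun f : WeakDual 𝕜 E => (f : E → 𝕜)) '' A).Equicontinuous) :
    ∃ q : Seminorm 𝕜 E, Continuous q ∧ A ⊆ dominated ⊤ q := by
  let : UniformSpace E := IsTopologicalAddGroup.rightUniformSpace E
  have : IsUniformAddGroup E := isUniformAddGroup_of_addCommGroup
  let φ : A → E →ₗ[𝕜] 𝕜 := fun f => (WeakDual.toStrongDual (f : WeakDual 𝕜 E)).toLinearMap
  have h : Equicontinuous ((↑) ∘ φ : A → E → 𝕜) := by
    rw [equicontinuous_iff_range]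
    convert hA using 1
    ext g
    simp only [φ, Set.mem_range, Set.mem_image, Function.comp_apply, Subtype.exists, exists_prop]
    rfl
  have := (((norm_withSeminorms 𝕜 𝕜).equicontinuous_TFAE φ).out 1 3).1 h
  obtain ⟨q, hq, hle⟩ := this 0
  exact ⟨q, hq, fun f hf => ⟨trivial, fun x => hle ⟨f, hf⟩ x⟩⟩

theorem isClosed_dominated_top (q : Seminorm 𝕜 E) :
    IsClosed (dominated (⊤ : Submodule 𝕜 (WeakDual 𝕜 E)) q) := by
  simpa [dominated] using isClosed_setOf_norm_le (𝕜 := 𝕜) (E := E) q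

/-- The subspaces that appear in the definition of a Pták space are the nearly closed ones. -/
theorem nearlyClosed_iff [IsTopologicalAddGroup E] [ContinuousSMul 𝕜 E]
    {Q : Submodule 𝕜 (WeakDual 𝕜 E)} :
    NearlyClosed Q ↔ ∀ A : Set (WeakDual 𝕜 E),
      Set.Equicontinuous ((fun f : WeakDual 𝕜 E ↦ (f : E → 𝕜)) '' A) →
      IsClosed ((Subtype.val : A → WeakDual 𝕜 E) ⁻¹' (Q : Set (WeakDual 𝕜 E))) := by
  refine ⟨fun h A hA => ?_, fun h q hq => ?_⟩
  · obtain ⟨q, hq, hAq⟩ := exists_subset_dominated_top hA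
    convert (h q hq).preimage (continuous_subtype_val (p := (· ∈ A))) using 1
    ext f
    exact ⟨fun hf => ⟨hf, (hAq f.2).2⟩, fun hf => hf.1⟩
  · have := (isClosed_dominated_top q).isClosedEmbedding_subtypeVal.isClosedMap _
      (h _ (equicontinuous_dominated_top hq))
    rw [Subtype.image_preimage_coe] at this
    convert this using 1
    ext f
    simp [dominated, and_comm]

theorem exists_dual_vanishing_ne_zero [Module ℝ E] [IsScalarTower ℝ 𝕜 E] [IsTopologicalAddGroup E]
    [ContinuousSMul 𝕜 E] [LocallyConvexSpace ℝ E] {S : Submodule 𝕜 E}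
    (hS : IsClosed (S : Set E)) {x : E} (hx : x ∉ S) :
    ∃ φ : StrongDual 𝕜 E, (∀ s ∈ S, φ s = 0) ∧ φ x ≠ 0 := by
  obtain ⟨φ, u, hφ, hu⟩ := RCLike.geometric_hahn_banach_closed_point (𝕜 := 𝕜)
    (S.restrictScalars ℝ).convex hS hx
  have h0 : 0 < u := by simpa using hφ 0 S.zero_mem
  refine ⟨φ, fun s hs => ?_, fun h => ?_⟩
  · by_contra hs0
    have := hφ (((u : 𝕜) / φ s) • s) (S.smul_mem _ hs)
    rw [map_smul, smul_eq_mul, div_mul_cancel₀ _ hs0, RCLike.ofReal_re] at this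
    exact this.false
  · rw [h, map_zero] at hu
    exact h0.not_gt hu

/-- The transpose of a continuous linear map, between weak duals. -/
noncomputable def transpose (π : E →L[𝕜] F) : WeakDual 𝕜 F →ₗ[𝕜] WeakDual 𝕜 E where
  toFun g := StrongDual.toWeakDual ((WeakDual.toStrongDual g).comp π)
  map_add' _ _ := rfl
  map_smul' _ _ := rfl

@[simp]
theorem transpose_apply (π : E →L[𝕜] F) (g : WeakDual 𝕜 F) (x : E) :
    transpose π g x = g (π x) := rfl

theorem continuous_transpose (π : E →L[𝕜] F) : Continuous (transpose π) :=
  WeakDual.continuous_of_continuous_eval fun x => WeakDual.eval_continuous (π x)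

theorem exists_transpose_eq {π : E →L[𝕜] F} (hπ : IsQuotientMap π) {f : WeakDual 𝕜 E}
    (hf : ∀ x, π x = 0 → f x = 0) : ∃ g, transpose π g = f := by
  let e := π.toLinearMap.quotKerEquivOfSurjective hπ.surjective
  let l : F →ₗ[𝕜] 𝕜 :=
    (π.toLinearMap.ker.liftQ (WeakDual.toStrongDual f).toLinearMap fun x hx => hf x hx).comp
      e.symm.toLinearMap
  have hl : ∀ x, l (π x) = f x := fun x => by
    have : e.symm (π x) = Submodule.Quotient.mk x := by
      rw [LinearEquiv.symm_apply_eq]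
      rfl
    simp only [l, LinearMap.comp_apply, LinearEquiv.coe_coe, this]
    rfl
  refine ⟨StrongDual.toWeakDual ⟨l, hπ.continuous_iff.2 ?_⟩, DFunLike.ext _ _ hl⟩
  convert (WeakDual.toStrongDual f).continuous using 1
  exact funext hl

/-- Every point of `F` is some `π x`, where evaluation is evaluation of the transpose at `x`; so the
topology is induced. The range is the annihilator of the kernel of `π`, hence closed. -/
theorem isClosedEmbedding_transpose {π : E →L[𝕜] F} (hπ : IsQuotientMap π) :
    IsClosedEmbedding (transpose π) := by
  refine ⟨⟨⟨le_antisymm (continuous_transpose π).le_induced ?_⟩, fun g h hgh => ?_⟩, ?_⟩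
  · refine continuous_iff_le_induced.1 ?_
    refine @continuous_pi _ _ _ (TopologicalSpace.induced _ _) _ _ fun y => ?_
    obtain ⟨x, rfl⟩ := hπ.surjective y
    have hx : Continuous fun f : WeakDual 𝕜 E => f x := WeakDual.eval_continuous x
    exact @Continuous.comp _ _ _ (.induced (transpose π) _) _ _ _ _ hx continuous_induced_dom
  · refine DFunLike.ext _ _ fun y => ?_
    obtain ⟨x, rfl⟩ := hπ.surjective y
    exact DFunLike.congr_fun hgh x
  · have : Set.range (transpose π) = {f | ∀ x, π x = 0 → f x = 0} := by
      ext f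
      refine ⟨?_, fun hf => exists_transpose_eq hπ hf⟩
      rintro ⟨g, rfl⟩ x hx
      simp [hx]
    rw [this]
    simp only [Set.ofPred_forall]
    exact isClosed_iInter fun x => isClosed_iInter fun _ =>
      isClosed_eq (WeakDual.eval_continuous x) continuous_const

theorem NearlyClosed.comap_transpose {Q : Submodule 𝕜 (WeakDual 𝕜 E)} (hQ : NearlyClosed Q)
    (π : E →L[𝕜] F) : NearlyClosed (Q.comap (transpose π)) := by
  intro q hq
  have h := ((hQ (q.comp π.toLinearMap) (hq.comp π.continuous)).preimage
    (continuous_transpose π)).inter (isClosed_setOf_norm_le (𝕜 := 𝕜) q)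
  convert h using 1
  ext g
  exact ⟨fun hg => ⟨⟨hg.1, fun x => hg.2 (π x)⟩, hg.2⟩, fun hg => ⟨hg.1.1, hg.2⟩⟩

/-- Quotients of barrelled spaces are barrelled. -/
theorem barrelledSpace_of_isQuotientMap [BarrelledSpace 𝕜 E] {π : E →L[𝕜] F}
    (hπ : IsQuotientMap π) : BarrelledSpace 𝕜 F where
  continuous_of_lowerSemicontinuous p hp := hπ.continuous_iff.2 <|
    Seminorm.continuous_of_lowerSemicontinuous (p.comp π.toLinearMap)
      (hp.comp π.continuous)

/-- The Pták property passes to quotients. -/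
theorem HasPtakProperty.of_isQuotientMap [IsTopologicalAddGroup E] (hE : HasPtakProperty 𝕜 E)
    {π : E →L[𝕜] F} (hπ : IsQuotientMap π) : HasPtakProperty 𝕜 F := by
  intro Q hQ
  have hemb := isClosedEmbedding_transpose hπ
  have hmap : NearlyClosed (Q.map (transpose π)) := by
    intro q hq
    let ι := {g : WeakDual 𝕜 F // g ∈ Q ∧ ∀ x, ‖g (π x)‖ ≤ q x}
    let s : ι → Seminorm 𝕜 F := fun g => (WeakDual.toStrongDual g.1).toLinearMap.toSeminorm
    have hbdd : BddAbove (Set.range s) := by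
      rw [Seminorm.bddAbove_range_iff]
      intro y
      obtain ⟨x, rfl⟩ := hπ.surjective y
      refine ⟨q x, ?_⟩
      rintro _ ⟨g, rfl⟩
      exact g.2.2 x
    -- The transposes dominated by `q` are exactly those of the members of `Q` dominated by `r`; and
    -- `r` is continuous because `r ∘ π ≤ q`.
    let r : Seminorm 𝕜 F := ⨆ g, s g
    have : Nonempty ι := ⟨⟨0, Q.zero_mem, fun x => by simp [weakDual_zero_apply]⟩⟩
    have hrq : r.comp π.toLinearMap ≤ q := fun x => by
      change (⨆ g, s g) (π x) ≤ q x
      rw [Seminorm.iSup_apply hbdd]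
      exact ciSup_le fun g => g.2.2 x
    have hr : Continuous r := hπ.continuous_iff.2 (Seminorm.continuous_of_le hq hrq)
    convert hemb.isClosedMap _ (hQ r hr) using 1
    ext f
    constructor
    · rintro ⟨⟨g, hg, rfl⟩, hfq⟩
      exact ⟨g, ⟨hg, fun y => le_ciSup hbdd (⟨g, hg, hfq⟩ : ι) y⟩, rfl⟩
    · rintro ⟨g, ⟨hg, hgr⟩, rfl⟩
      exact ⟨⟨g, hg, rfl⟩, fun x => (hgr (π x)).trans (hrq x)⟩
  have := (hE _ hmap).preimage hemb.continuous
  rwa [Submodule.map_coe, Set.preimage_image_eq _ hemb.injective] at this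

end Duality

/-! ### The closed graph theorem -/

section ClosedGraph

variable {E F : Type*} [AddCommGroup E] [Module 𝕜 E] [TopologicalSpace E] [BarrelledSpace 𝕜 E]
  [AddCommGroup F] [Module 𝕜 F] [TopologicalSpace F]

/-- The functionals whose composition with `f` is continuous. -/
def continuousPullbacks {E F : Type*} [AddCommGroup E] [Module 𝕜 E] [TopologicalSpace E]
    [AddCommGroup F] [Module 𝕜 F] [TopologicalSpace F] (f : E →ₗ[𝕜] F) : Submodule 𝕜 (WeakDual 𝕜 F) where
  carrier := {g | Continuous fun x => g (f x)}
  add_mem' ha hb := ha.add hb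
  zero_mem' := continuous_const
  smul_mem' c _ hg := hg.const_smul c

/-- Uniform boundedness: the pullbacks are continuous and pointwise bounded by `q ∘ f`, so their
supremum is continuous as `E` is barrelled, although `f` itself need not be. -/
theorem exists_continuous_seminorm_dominating (f : E →ₗ[𝕜] F) (q : Seminorm 𝕜 F) :
    ∃ p : Seminorm 𝕜 E, Continuous p ∧
      ∀ g ∈ dominated (continuousPullbacks f) q, ∀ x, ‖g (f x)‖ ≤ p x := by
  let s : dominated (continuousPullbacks f) q → Seminorm 𝕜 E := fun g =>
    (WeakDual.toStrongDual g.1).toLinearMap.toSeminorm.comp f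
  have hbdd : BddAbove (Set.range s) := ⟨q.comp f, by
    rintro _ ⟨g, rfl⟩ x
    exact g.2.2 (f x)⟩
  have hc := Seminorm.continuous_iSup s (fun g => g.2.1.norm) hbdd
  rw [← Seminorm.coe_iSup_eq hbdd] at hc
  refine ⟨⨆ g, s g, hc, fun g hg x => ?_⟩
  exact le_ciSup hbdd (⟨g, hg⟩ : dominated (continuousPullbacks f) q) x

/-- Among functionals dominated by `q`, continuity of the pullback amounts to domination by one
fixed continuous seminorm, which is a pointwise closed condition. -/
theorem nearlyClosed_continuousPullbacks [IsTopologicalAddGroup E] (f : E →ₗ[𝕜] F) :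
    NearlyClosed (continuousPullbacks f) := by
  intro q _
  obtain ⟨p, hp, hle⟩ := exists_continuous_seminorm_dominating f q
  have : dominated (continuousPullbacks f) q =
      {g | ∀ y, ‖g y‖ ≤ q y} ∩ {g | ∀ x, ‖g (f x)‖ ≤ p x} := by
    ext g
    refine ⟨fun hg => ⟨hg.2, hle g hg⟩, fun hg => ⟨?_, hg.1⟩⟩
    exact continuous_of_norm_le (f := (WeakDual.toStrongDual g).toLinearMap.comp f) hp hg.2
  rw [this]
  refine (isClosed_setOf_norm_le q).inter ?_
  simp only [Set.ofPred_forall]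
  exact isClosed_iInter fun x =>
    isClosed_le (WeakDual.eval_continuous (f x)).norm continuous_const

variable [IsTopologicalAddGroup E] [ContinuousSMul 𝕜 E] [Module ℝ E] [IsScalarTower ℝ 𝕜 E]
  [LocallyConvexSpace ℝ E] [IsTopologicalAddGroup F] [ContinuousSMul 𝕜 F] [Module ℝ F]
  [IsScalarTower ℝ 𝕜 F] [LocallyConvexSpace ℝ F]

/-- The **closed graph theorem** for maps from a barrelled space to a Pták space. -/
theorem continuous_of_isClosed_graph (hF : HasPtakProperty 𝕜 F) (f : E →ₗ[𝕜] F)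
    (hf : IsClosed (f.graph : Set (E × F))) : Continuous f := by
  have htop : ∀ g : WeakDual 𝕜 F, g ∈ continuousPullbacks f := by
    intro g
    by_contra hg
    obtain ⟨y, hy, hgy⟩ := exists_ne_zero_of_notMem
      (hF _ (nearlyClosed_continuousPullbacks f)) hg
    have hy0 : ((0 : E), y) ∉ f.graph := by
      rw [LinearMap.mem_graph_iff, map_zero]
      rintro h
      exact hgy (by rw [show y = 0 from h, map_zero])
    -- Since `φ` vanishes on the graph, `φ (0, f x) = -φ (x, 0)` is continuous in `x`. Hence `φ (0,
    -- ·)` is a continuous pullback and must kill `y`, a contradiction.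
    obtain ⟨φ, hφ, hφy⟩ := exists_dual_vanishing_ne_zero hf hy0
    refine hφy (hy (StrongDual.toWeakDual (φ.comp (ContinuousLinearMap.inr 𝕜 E F))) ?_)
    have h : ∀ x, φ (0, f x) = -φ (x, 0) := fun x => by
      rw [eq_neg_iff_add_eq_zero, ← map_add]
      exact hφ _ (by simp [LinearMap.mem_graph_iff])
    change Continuous fun x => φ (0, f x)
    simp only [h]
    exact (φ.continuous.comp (continuous_id.prodMk continuous_const)).neg
  have : PolynormableSpace 𝕜 F := polynormableSpace_of_locallyConvexSpace_real
  refine (PolynormableSpace.withSeminorms 𝕜 F).continuous_of_continuous_comp f fun q => ?_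
  obtain ⟨p, hp, hle⟩ := exists_continuous_seminorm_dominating f q.1
  refine Seminorm.continuous_of_le hp fun x => ?_
  obtain ⟨g, hg, hgx⟩ := exists_dual_le_seminorm_apply_eq q.1 (f x)
  let g' : WeakDual 𝕜 F := StrongDual.toWeakDual ⟨g, continuous_of_norm_le q.2 hg⟩
  exact hgx.symm.le.trans (hle g' ⟨htop g', hg⟩ x)

end ClosedGraph

/-! ### Banach spaces are Pták: Krein–Šmulian -/

section Banach

variable {B : Type*} [NormedAddCommGroup B] [NormedSpace 𝕜 B]

/-- The splitting with the norm and its double gives `‖y‖ + 2 p (z - y) < r`, where `p` is the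
supremum seminorm of the norm; the factor `2` halves the remainder. -/
theorem NearlyClosed.exists_approx {Q : Submodule 𝕜 (WeakDual 𝕜 B)} (hQ : NearlyClosed Q)
    {z : B} {r : ℝ} (hz : supSeminorm Q (normSeminorm 𝕜 B) z < r) :
    ∃ y, ‖y‖ ≤ r ∧ supSeminorm Q (normSeminorm 𝕜 B) (z - y) < r / 2 := by
  have hn : Continuous (normSeminorm 𝕜 B) := continuous_norm
  have hn2 : Continuous ((2 : NNReal) • normSeminorm 𝕜 B) := continuous_const.mul hn
  have h := (hQ.inf_supSeminorm_le hn hn2 z).trans_lt hz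
  rw [Seminorm.inf_apply] at h
  obtain ⟨y, hy⟩ := exists_lt_of_ciInf_lt h
  have h2 := mul_supSeminorm_le (Q := Q) (q := normSeminorm 𝕜 B) 2 (z - y)
  have h3 : 0 ≤ ‖y‖ := norm_nonneg y
  have h4 := apply_nonneg (supSeminorm Q (normSeminorm 𝕜 B)) (z - y)
  rw [coe_normSeminorm] at hy
  simp only [NNReal.coe_ofNat] at h2
  exact ⟨y, by linarith, by linarith⟩

theorem NearlyClosed.exists_norm_le [CompleteSpace B] {Q : Submodule 𝕜 (WeakDual 𝕜 B)}
    (hQ : NearlyClosed Q) {x : B} {r : ℝ} (hx : supSeminorm Q (normSeminorm 𝕜 B) x < r / 2) :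
    ∃ y, ‖y‖ ≤ r ∧ supSeminorm Q (normSeminorm 𝕜 B) (x - y) = 0 := by
  set p := supSeminorm Q (normSeminorm 𝕜 B) with hp
  choose! a ha hpa using fun (z : B) (r : ℝ) (h : p z < r) => hQ.exists_approx h
  -- Successive remainders: the `n`-th correction has norm at most `r / 2 / 2 ^ n`, and these bounds
  -- sum to `r`.
  let z : ℕ → B := fun n => Nat.rec x (fun n z => z - a z (r / 2 / 2 ^ n)) n
  have hz : ∀ n, p (z n) < r / 2 / 2 ^ n := by
    intro n
    induction n with
    | zero => simpa [z] using hx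
    | succ n ih =>
      have := hpa _ _ ih
      rw [pow_succ, ← div_div]
      exact this
  let y : ℕ → B := fun n => a (z n) (r / 2 / 2 ^ n)
  have hy : ∀ n, ‖y n‖ ≤ r / 2 / 2 ^ n := fun n => ha _ _ (hz n)
  have hsum : Summable y := .of_norm_bounded (hasSum_geometric_two' r).summable hy
  have hpart : ∀ n, z n = x - ∑ i ∈ Finset.range n, y i := by
    intro n
    induction n with
    | zero => simp [z]
    | succ n ih =>
      rw [Finset.sum_range_succ, ← sub_sub, ← ih]
  refine ⟨∑' n, y n, tsum_of_norm_bounded (hasSum_geometric_two' r) hy, ?_⟩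
  have hpc : Continuous p := Seminorm.continuous_of_le
    (continuous_norm : Continuous (normSeminorm 𝕜 B)) supSeminorm_le
  have h1 : Filter.Tendsto (fun n => p (z n)) Filter.atTop (𝓝 (p (x - ∑' n, y n))) := by
    simp only [hpart]
    exact (hpc.tendsto _).comp (hsum.hasSum.tendsto_sum_nat.const_sub x)
  refine tendsto_nhds_unique h1 (squeeze_zero (fun n => apply_nonneg p _) (fun n => (hz n).le) ?_)
  exact (hasSum_geometric_two' r).summable.tendsto_atTop_zero

/-- The **Krein–Šmulian theorem** for subspaces: Banach spaces have the Pták property. -/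
theorem hasPtakProperty_of_completeSpace [CompleteSpace B] : HasPtakProperty 𝕜 B := by
  intro Q hQ
  have hn : Continuous (normSeminorm 𝕜 B) := continuous_norm
  refine isClosed_of_forall_mem fun f hf => ?_
  let c : NNReal := 2 * ‖WeakDual.toStrongDual f‖₊
  refine hQ.mem_of_norm_le (q := c • normSeminorm 𝕜 B) (continuous_const.mul hn) fun x => ?_
  refine le_trans ?_ (mul_supSeminorm_le c x)
  have hfx : ∀ r, 2 * supSeminorm Q (normSeminorm 𝕜 B) x < r →
      ‖f x‖ ≤ ‖WeakDual.toStrongDual f‖ * r := by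
    intro r hr
    obtain ⟨y, hy, hxy⟩ := hQ.exists_norm_le (x := x) (r := r) (by linarith)
    -- Every `g ∈ Q` has a nonzero multiple in the dual unit ball, so it vanishes at `x - y`; hence
    -- so does `f`.
    have h0 : f (x - y) = 0 := by
      refine hf _ fun g hg => ?_
      let d : 𝕜 := ((‖WeakDual.toStrongDual g‖ + 1)⁻¹ : ℝ)
      have hd : ‖d‖ = (‖WeakDual.toStrongDual g‖ + 1)⁻¹ := by
        rw [RCLike.norm_ofReal, abs_of_pos (by positivity)]
      have hmem : d • g ∈ dominated Q (normSeminorm 𝕜 B) := by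
        refine ⟨Q.smul_mem _ hg, fun z => ?_⟩
        rw [weakDual_smul_apply, norm_mul, hd, inv_mul_le_iff₀ (by positivity), coe_normSeminorm]
        refine ((WeakDual.toStrongDual g).le_opNorm z).trans ?_
        gcongr
        linarith
      have := norm_le_supSeminorm hmem (x - y)
      rw [hxy, weakDual_smul_apply, norm_le_zero_iff, mul_eq_zero] at this
      refine this.resolve_left fun h => ?_
      rw [h, norm_zero] at hd
      exact absurd hd (by positivity)
    rw [map_sub, sub_eq_zero] at h0
    rw [h0]
    exact ((WeakDual.toStrongDual f).le_opNorm y).trans (by gcongr)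
  have : ‖f x‖ ≤ ‖WeakDual.toStrongDual f‖ * (2 * supSeminorm Q (normSeminorm 𝕜 B) x) := by
    refine ge_of_tendsto (x := 𝓝[>] (2 * supSeminorm Q (normSeminorm 𝕜 B) x))
      (f := fun r => ‖WeakDual.toStrongDual f‖ * r) ?_ ?_
    · exact ((continuous_const.mul continuous_id).tendsto _).mono_left nhdsWithin_le_nhds
    · filter_upwards [self_mem_nhdsWithin] with r hr using hfx r hr
  refine this.trans_eq ?_
  simp only [c, NNReal.coe_mul, NNReal.coe_ofNat, coe_nnnorm]
  ring

end Banach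

end PtakSpace

/-! ### Links between (O), (C), (G), and admissibility of barreled Pták spaces -/

namespace LCS

open PtakSpace

variable {𝕜 : Type v} [RCLike 𝕜]

theorem isPtak_iff {E : LCS.{u, v} 𝕜} : E.IsPtak ↔ HasPtakProperty 𝕜 E :=
  forall_congr' fun _ => imp_congr_left nearlyClosed_iff.symm

theorem mem_barreledPtak_of_isQuotientMap {E F : LCS.{u, v} 𝕜} (hE : E ∈ barreledPtak 𝕜)
    (f : E →ₗ[𝕜] F) (hf : IsQuotientMap f) : F ∈ barreledPtak 𝕜 := by
  let π : E →L[𝕜] F := ⟨f, hf.continuous⟩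
  have := hE.1
  exact ⟨barrelledSpace_of_isQuotientMap (π := π) hf,
    isPtak_iff.2 ((isPtak_iff.1 hE.2).of_isQuotientMap (π := π) hf)⟩

theorem continuous_of_isClosed_graph {E F : LCS.{u, v} 𝕜} [BarrelledSpace 𝕜 E] (hF : F.IsPtak)
    (f : E →ₗ[𝕜] F) (hf : IsClosed (f.graph : Set (E × F))) : Continuous f :=
  PtakSpace.continuous_of_isClosed_graph (isPtak_iff.1 hF) f hf

theorem isClosed_graph {E F : LCS.{u, v} 𝕜} {f : E →ₗ[𝕜] F} (hf : Continuous f) :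
    IsClosed (f.graph : Set (E × F)) := by
  have : (f.graph : Set (E × F)) = {x | x.2 = f x.1} := rfl
  rw [this]
  exact isClosed_eq continuous_snd (hf.comp continuous_fst)

theorem isClosed_graph_symm {E F : LCS.{u, v} 𝕜} (f : E ≃ₗ[𝕜] F)
    (hf : IsClosed (f.toLinearMap.graph : Set (E × F))) :
    IsClosed (f.symm.toLinearMap.graph : Set (F × E)) := by
  convert hf.preimage continuous_swap using 1
  ext ⟨y, x⟩
  change x = f.symm y ↔ y = f x
  rw [LinearEquiv.eq_symm_apply, eq_comm]

/-! Relations between the properties of a class of locally convex spaces. -/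

theorem ClosedGraphProperty.continuousInverseProperty {C : Set (LCS.{u, v} 𝕜)}
    (hC : ClosedGraphProperty C) : ContinuousInverseProperty C := by
  have key : ∀ E ∈ C, ∀ F ∈ C, ∀ f : E ≃ₗ[𝕜] F, Continuous f → Continuous f.symm :=
    fun E hE F hF f hf =>
      (hC F hF E hE f.symm.toLinearMap).1 (isClosed_graph_symm f (isClosed_graph hf))
  exact fun E hE F hF f => ⟨key E hE F hF f, key F hF E hE f.symm⟩

theorem OpenMappingProperty.continuousInverseProperty {C : Set (LCS.{u, v} 𝕜)}
    (hC : OpenMappingProperty C) : ContinuousInverseProperty C := by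
  have key : ∀ E ∈ C, ∀ F ∈ C, ∀ f : E ≃ₗ[𝕜] F, Continuous f → Continuous f.symm :=
    fun E hE F hF f hf => by
      have := hC E hE F hF f.toLinearMap f.surjective hf
      exact (f.toEquiv.toHomeomorphOfContinuousOpen hf this).symm.continuous
  exact fun E hE F hF f => ⟨key E hE F hF f, key F hF E hE f.symm⟩

/-- The graph of a linear map, as a space isomorphic to the domain. -/
noncomputable def graphEquiv {E F : LCS.{u, v} 𝕜} (f : E →ₗ[𝕜] F) : graph f ≃ₗ[𝕜] E :=
  show f.graph ≃ₗ[𝕜] E from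
  { toFun := fun x => x.1.1
    map_add' := fun _ _ => rfl
    map_smul' := fun _ _ => rfl
    invFun := fun x => ⟨(x, f x), rfl⟩
    left_inv := fun x => Subtype.ext (Prod.ext rfl x.2.symm)
    right_inv := fun _ => rfl }

theorem continuous_graphEquiv {E F : LCS.{u, v} 𝕜} (f : E →ₗ[𝕜] F) :
    Continuous (graphEquiv f) :=
  (continuous_fst.comp continuous_subtype_val : Continuous fun x : f.graph => x.1.1)

theorem continuous_graphEquiv_symm_iff {E F : LCS.{u, v} 𝕜} {f : E →ₗ[𝕜] F} :
    Continuous (graphEquiv f).symm ↔ Continuous f := by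
  refine ⟨fun h => ?_, fun h => ?_⟩
  · exact (continuous_snd.comp continuous_subtype_val :
      Continuous fun x : f.graph => x.1.2).comp h
  · exact (continuous_id.prodMk h).subtype_mk _

/-- The projection of the graph onto the domain is a continuous bijection, with inverse `x ↦ (x, f
x)`; this is continuous exactly when `f` is. -/
theorem ContinuousInverseProperty.closedGraphProperty {C : Set (LCS.{u, v} 𝕜)}
    (hC : ContinuousInverseProperty C) (hg : ClosedUnderClosedGraphs C) :
    ClosedGraphProperty C := fun E hE F hF f =>
  ⟨fun hf => continuous_graphEquiv_symm_iff.1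
    ((hC _ (hg E hE F hF f hf) _ hE (graphEquiv f)).1 (continuous_graphEquiv f)), isClosed_graph⟩

theorem ContinuousInverseProperty.openMappingProperty {C : Set (LCS.{u, v} 𝕜)}
    (hC : ContinuousInverseProperty C) (hq : ClosedUnderQuotients C) :
    OpenMappingProperty C := by
  intro E hE F hF f hs hf
  have hN : IsClosed (f.ker : Set E) := isClosed_singleton.preimage hf
  let e : E.quot f.ker hN ≃ₗ[𝕜] F := f.quotKerEquivOfSurjective hs
  have he : Continuous e := f.ker.isOpenQuotientMap_mkQ.isQuotientMap.continuous_iff.2 hf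
  have he' := (hC _ (hq E hE _ hN) _ hF e).1 he
  exact (Homeomorph.mk e.toEquiv he he').isOpenMap.comp f.ker.isOpenMap_mkQ

theorem Admissible.closedGraphProperty {C : Set (LCS.{u, v} 𝕜)} (hC : Admissible C) :
    ClosedGraphProperty C := by
  rcases hC.openInverseOrGraph with h | h | h
  · exact h.continuousInverseProperty.closedGraphProperty hC.graphs
  · exact h.closedGraphProperty hC.graphs
  · exact h

/-! The class of barreled Pták spaces is admissible. -/

theorem closedGraphProperty_barreledPtak : ClosedGraphProperty (barreledPtak.{u, v} 𝕜) :=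
  fun _ hE _ hF f => have := hE.1; ⟨continuous_of_isClosed_graph hF.2 f, isClosed_graph⟩

theorem containsBanachSpaces_barreledPtak : ContainsBanachSpaces (barreledPtak.{u, v} 𝕜) :=
  fun B _ _ _ => ⟨(inferInstance : BarrelledSpace 𝕜 B),
    isPtak_iff.2 (hasPtakProperty_of_completeSpace (𝕜 := 𝕜) (B := B))⟩

theorem closedUnderQuotients_barreledPtak : ClosedUnderQuotients (barreledPtak.{u, v} 𝕜) :=
  fun _ hE N hN => mem_barreledPtak_of_isQuotientMap (F := quot _ N hN) hE N.mkQ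
    N.isOpenQuotientMap_mkQ.isQuotientMap

theorem closedUnderClosedGraphs_barreledPtak :
    ClosedUnderClosedGraphs (barreledPtak.{u, v} 𝕜) := fun E hE F hF f hf =>
  mem_barreledPtak_of_isQuotientMap hE (graphEquiv f).symm.toLinearMap
    (Homeomorph.mk (graphEquiv f).symm.toEquiv (continuous_graphEquiv_symm_iff.2
      ((closedGraphProperty_barreledPtak E hE F hF f).1 hf))
      (continuous_graphEquiv f)).isQuotientMap

/-- A lower semicontinuous `p` pulls back to a continuous seminorm. Its unit ball has image dense in
a neighbourhood of zero, which lies in the closed set `p ≤ 1`. -/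
theorem barrelledSpace_range {E F : LCS.{u, v} 𝕜} [BarrelledSpace 𝕜 E] {f : E →ₗ[𝕜] F}
    (hf : Continuous f) (hn : NearlyOpen f) : BarrelledSpace 𝕜 (F.sub (LinearMap.range f)) where
  continuous_of_lowerSemicontinuous p hp := by
    change Seminorm 𝕜 (LinearMap.range f) at p
    have hc : Continuous f.rangeRestrict := hf.subtype_mk _
    have hpc : Continuous (p.comp f.rangeRestrict) :=
      Seminorm.continuous_of_lowerSemicontinuous _ (hp.comp hc)
    obtain ⟨V, hV, -, hVc⟩ := hn _ (Seminorm.ball_mem_nhds hpc one_pos)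
    have : Continuous p := by
      refine Seminorm.continuous' (r := 1) (Filter.mem_of_superset hV (hVc.trans ?_))
      rw [Seminorm.closedBall_zero_eq]
      refine closure_minimal ?_ (hp.isClosed_preimage 1)
      rintro _ ⟨x, hx, rfl⟩
      rw [Seminorm.mem_ball_zero] at hx
      exact hx.le
    exact this

theorem closedUnderContinuousImages_barreledPtak :
    ClosedUnderContinuousImages (barreledPtak.{u, v} 𝕜) := by
  intro E hE F f hi hf hn
  have := hE.1
  have := barrelledSpace_range hf hn
  let e : E ≃ₗ[𝕜] F.sub (LinearMap.range f) := LinearEquiv.ofInjective f hi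
  have he : Continuous e := hf.subtype_mk _
  -- The closed graph theorem applies to the inverse, from the barrelled range to the Pták space
  -- `E`.
  have he' : Continuous e.symm :=
    continuous_of_isClosed_graph hE.2 e.symm.toLinearMap (isClosed_graph_symm e (isClosed_graph he))
  exact mem_barreledPtak_of_isQuotientMap hE e.toLinearMap
    (Homeomorph.mk e.toEquiv he he').isQuotientMap

theorem admissible_barreledPtak : Admissible (barreledPtak.{u, v} 𝕜) where
  banach := containsBanachSpaces_barreledPtak
  quotients := closedUnderQuotients_barreledPtak
  graphs := closedUnderClosedGraphs_barreledPtak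
  images := closedUnderContinuousImages_barreledPtak
  openInverseOrGraph := .inr (.inr closedGraphProperty_barreledPtak)

end LCS

/-! ### Banach completions of seminorms -/

namespace PtakSpace

variable {𝕜 : Type v} [RCLike 𝕜]

/-- The completion of a seminormed vector space. -/
theorem exists_banach_completion {V : Type u} [AddCommGroup V] [Module 𝕜 V] (p : Seminorm 𝕜 V) :
    ∃ (B : Type u) (_ : NormedAddCommGroup B) (_ : NormedSpace 𝕜 B) (_ : CompleteSpace B)
      (T : V →ₗ[𝕜] B), DenseRange T ∧ ∀ x, ‖T x‖ = p x := by
  let _ : SeminormedAddCommGroup V := p.toSeminormedAddCommGroup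
  let _ : NormedSpace 𝕜 V := { norm_smul_le := fun c x => (map_smul_eq_mul p c x).le }
  exact ⟨UniformSpace.Completion V, inferInstance, inferInstance, inferInstance,
    (UniformSpace.Completion.toComplₗᵢ (𝕜 := 𝕜) (E := V)).toLinearMap,
    UniformSpace.Completion.denseRange_coe, fun x => UniformSpace.Completion.norm_coe x⟩

/-- The map to the completion with respect to a lower semicontinuous seminorm has closed graph. -/
theorem isClosed_graph_of_lowerSemicontinuous {V B : Type*} [AddCommGroup V] [Module 𝕜 V]
    [TopologicalSpace V] [IsTopologicalAddGroup V] [NormedAddCommGroup B] [NormedSpace 𝕜 B]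
    {p : Seminorm 𝕜 V} (hp : LowerSemicontinuous p) {T : V →ₗ[𝕜] B} (hd : DenseRange T)
    (hT : ∀ x, ‖T x‖ = p x) : IsClosed (T.graph : Set (V × B)) := by
  rw [← closure_subset_iff_isClosed]
  rintro ⟨x, b⟩ hxb
  change b = T x
  rw [← sub_eq_zero, ← norm_le_zero_iff]
  refine le_of_forall_pos_le_add fun ε hε => ?_
  -- Approximate the defect `b - T x` by `T a`. Graph points `(z, T z)` near `(x, b)` satisfy `p (z
  -- - x - a) < ε / 2`; lower semicontinuity lets `z` tend to `x`, giving `p a ≤ ε / 2`.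
  obtain ⟨a, ha⟩ := hd.exists_dist_lt (b - T x) (half_pos hε)
  rw [dist_eq_norm] at ha
  have hcl : IsClosed {z : V | p (z - x - a) ≤ ε / 2} :=
    (hp.comp ((continuous_id.sub continuous_const).sub continuous_const)).isClosed_preimage _
  have hpa : p a ≤ ε / 2 := by
    have hmem : x ∈ {z : V | p (z - x - a) ≤ ε / 2} := by
      refine hcl.closure_eq ▸ ?_
      rw [mem_closure_iff_nhds]
      intro U hU
      have hW : {c : B | ‖c - T x - T a‖ < ε / 2} ∈ 𝓝 b := by
        refine (isOpen_lt (by fun_prop) continuous_const).mem_nhds ?_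
        exact ha
      obtain ⟨⟨z, c⟩, ⟨hz, hc⟩, hg⟩ :=
        mem_closure_iff_nhds.1 hxb (U ×ˢ {c | ‖c - T x - T a‖ < ε / 2}) (prod_mem_nhds hU hW)
      have hg' : c = T z := hg
      refine ⟨z, hz, ?_⟩
      change p (z - x - a) ≤ ε / 2
      rw [← hT, map_sub, map_sub, ← hg']
      exact le_of_lt hc
    simpa using hmem
  calc ‖b - T x‖ = ‖(b - T x - T a) + T a‖ := by rw [sub_add_cancel]
    _ ≤ ‖b - T x - T a‖ + ‖T a‖ := norm_add_le _ _
    _ ≤ 0 + ε := by rw [hT]; linarith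

end PtakSpace

/-! ### Members of admissible classes are barreled Pták spaces -/

namespace LCS

open PtakSpace

variable {𝕜 : Type v} [RCLike 𝕜]

/-- Members of an admissible class are barrelled. -/
theorem Admissible.barrelledSpace {C : Set (LCS.{u, v} 𝕜)} (hC : Admissible C)
    {E : LCS.{u, v} 𝕜} (hE : E ∈ C) : BarrelledSpace 𝕜 E where
  continuous_of_lowerSemicontinuous p hp := by
    obtain ⟨B, _, _, _, T, hd, hT⟩ := exists_banach_completion p
    have hg : IsClosed (T.graph : Set (E × B)) := isClosed_graph_of_lowerSemicontinuous hp hd hT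
    have hc : Continuous T :=
      (hC.closedGraphProperty E hE (ofNormed B) (hC.banach B) T).1 hg
    simpa only [hT] using hc.norm

/-- A vector space with the topology of a separating family of seminorms. -/
def ofSeminorms {V : Type u} [AddCommGroup V] [Module 𝕜 V] [Module ℝ V] [IsScalarTower ℝ 𝕜 V]
    {ι : Type*} (p : SeminormFamily 𝕜 V ι) (hp : ∀ x ≠ 0, ∃ i, p i x ≠ 0) : LCS.{u, v} 𝕜 :=
  letI : TopologicalSpace V := p.moduleFilterBasis.topology
  have h : WithSeminorms p := ⟨rfl⟩
  haveI := h.topologicalAddGroup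
  haveI := h.continuousSMul
  haveI := h.toLocallyConvexSpace
  haveI := h.T1_of_separating hp
  { carrier := V }

section Coarsening

variable {E : LCS.{u, v} 𝕜} (Q : Submodule 𝕜 (WeakDual 𝕜 E))

theorem exists_supSeminorm_ne_zero (hs : ∀ x ≠ 0, ∃ g ∈ Q, g x ≠ 0) (x : E) (hx : x ≠ 0) :
    ∃ q : {q : Seminorm 𝕜 E // Continuous q}, supSeminorm Q q.1 x ≠ 0 := by
  obtain ⟨g, hg, hgx⟩ := hs x hx
  refine ⟨⟨(WeakDual.toStrongDual g).toLinearMap.toSeminorm, g.continuous.norm⟩, ?_⟩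
  have := norm_le_supSeminorm (q := (WeakDual.toStrongDual g).toLinearMap.toSeminorm)
    ⟨hg, fun _ => le_rfl⟩ x
  exact ((norm_pos_iff.2 hgx).trans_le this).ne'

/-- The space `E` with the topology of uniform convergence on equicontinuous subsets of `Q`. -/
noncomputable def coarsening (hs : ∀ x ≠ 0, ∃ g ∈ Q, g x ≠ 0) : LCS.{u, v} 𝕜 :=
  ofSeminorms (fun q : {q : Seminorm 𝕜 E // Continuous q} => supSeminorm Q q.1)
    (exists_supSeminorm_ne_zero Q hs)

variable {Q} (hs : ∀ x ≠ 0, ∃ g ∈ Q, g x ≠ 0)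

/-- The identity, as a map to the coarsening. -/
noncomputable def toCoarsening : E ≃ₗ[𝕜] coarsening Q hs := LinearEquiv.refl 𝕜 E

/-- The defining seminorms of the coarsening. -/
noncomputable def coarseningSeminorm :
    SeminormFamily 𝕜 (coarsening Q hs) {q : Seminorm 𝕜 E // Continuous q} :=
  fun q => (supSeminorm Q q.1 : Seminorm 𝕜 E)

theorem coarseningSeminorm_apply (q : {q : Seminorm 𝕜 E // Continuous q}) (x : E) :
    coarseningSeminorm hs q (toCoarsening hs x) = supSeminorm Q q.1 x := rfl

theorem withSeminorms_coarsening : WithSeminorms (coarseningSeminorm hs) := ⟨rfl⟩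

theorem continuous_toCoarsening : Continuous (toCoarsening hs) :=
  (withSeminorms_coarsening hs).continuous_of_continuous_comp (toCoarsening hs).toLinearMap
    fun q => Seminorm.continuous_of_le q.2 (supSeminorm_le (Q := Q) (q := q.1))

theorem continuous_finset_sup_continuousSeminorm {E : LCS.{u, v} 𝕜}
    (s : Finset {q : Seminorm 𝕜 E // Continuous q}) :
    Continuous (s.sup fun q => q.1 : Seminorm 𝕜 E) :=
  Seminorm.continuous_finsetSup fun q _ => q.2

theorem exists_finset_sup_coarseningSeminorm_le (s : Finset {q : Seminorm 𝕜 E // Continuous q}) :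
    ∃ q : {q : Seminorm 𝕜 E // Continuous q},
      s.sup (coarseningSeminorm hs) ≤ coarseningSeminorm hs q := by
  refine ⟨⟨s.sup fun q => q.1, continuous_finset_sup_continuousSeminorm s⟩, Finset.sup_le fun q hq => ?_⟩
  exact supSeminorm_mono (Q := Q) (Finset.le_sup (f := fun q : {q : Seminorm 𝕜 E // Continuous q}
    => q.1) hq)

/-- The coarsening has no dual beyond `Q`: its seminorms are directed, so a continuous functional is
dominated by a multiple of one of them, and `NearlyClosed.mem_of_norm_le` applies. -/
theorem mem_of_continuous_coarsening (hQ : NearlyClosed Q) {f : WeakDual 𝕜 E}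
    (hf : Continuous fun y => f ((toCoarsening hs).symm y)) : f ∈ Q := by
  let r : Seminorm 𝕜 (coarsening Q hs) :=
    ((WeakDual.toStrongDual f).toLinearMap.comp (toCoarsening hs).symm.toLinearMap).toSeminorm
  obtain ⟨s, c, -, hle⟩ := Seminorm.bound_of_continuous (withSeminorms_coarsening hs) r hf.norm
  obtain ⟨q, hq⟩ := exists_finset_sup_coarseningSeminorm_le hs s
  refine hQ.mem_of_norm_le (q := c • q.1) (continuous_const.mul q.2) fun x => ?_
  refine le_trans ?_ (mul_supSeminorm_le c x)
  refine (hle (toCoarsening hs x)).trans ?_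
  exact mul_le_mul_of_nonneg_left (hq (toCoarsening hs x)) c.2

theorem supSeminorm_ball_subset_closure (hQ : NearlyClosed Q) {q : Seminorm 𝕜 E}
    (hq : Continuous q) :
    (coarseningSeminorm hs ⟨q, hq⟩).ball 0 1 ⊆ closure (toCoarsening hs '' q.ball 0 1) := by
  intro z hz
  obtain ⟨x, rfl⟩ := (toCoarsening hs).surjective z
  rw [Seminorm.mem_ball_zero, coarseningSeminorm_apply] at hz
  rw [mem_closure_iff_nhds]
  intro U hU
  obtain ⟨s, r, hr, hU⟩ := ((withSeminorms_coarsening hs).mem_nhds_iff _ _).1 hU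
  obtain ⟨q', hq'⟩ := exists_finset_sup_coarseningSeminorm_le hs s
  -- Scaling `q'` by `r⁻¹` lets a single splitting of total size below `1` give both `q y < 1` and a
  -- remainder of size below `r` for `supSeminorm Q q'`.
  let c : NNReal := ⟨r⁻¹, (inv_pos.2 hr).le⟩
  have h := (hQ.inf_supSeminorm_le hq (q' := c • q'.1) (continuous_const.mul q'.2) x).trans_lt hz
  rw [Seminorm.inf_apply] at h
  obtain ⟨y, hy⟩ := exists_lt_of_ciInf_lt h
  have h1 := apply_nonneg q y
  have h2 := apply_nonneg (supSeminorm Q (c • q'.1)) (x - y)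
  refine ⟨toCoarsening hs y, hU ?_, Set.mem_image_of_mem _ ?_⟩
  · rw [Seminorm.mem_ball, ← map_sub (toCoarsening hs)]
    refine (hq' _).trans_lt ?_
    rw [coarseningSeminorm_apply, map_sub_rev (supSeminorm Q q'.1)]
    have h3 : r⁻¹ * supSeminorm Q q'.1 (x - y) < 1 :=
      (mul_supSeminorm_le c (x - y)).trans_lt (by linarith)
    rwa [inv_mul_lt_iff₀ hr, mul_one] at h3
  · rw [Seminorm.mem_ball_zero]
    linarith

theorem nearlyOpen_toCoarsening (hQ : NearlyClosed Q) :
    NearlyOpen (toCoarsening hs).toLinearMap := by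
  intro U hU
  have : PolynormableSpace 𝕜 E := polynormableSpace_of_locallyConvexSpace_real
  obtain ⟨s, r, hr, hsU⟩ := ((PolynormableSpace.withSeminorms 𝕜 E).mem_nhds_iff _ _).1 hU
  let c : NNReal := ⟨r⁻¹, (inv_pos.2 hr).le⟩
  let q : Seminorm 𝕜 E := c • s.sup fun q => q.1
  have hq : Continuous q := continuous_const.mul (continuous_finset_sup_continuousSeminorm s)
  have hqU : q.ball 0 1 ⊆ U := by
    refine Set.Subset.trans (fun x hx => ?_) hsU
    rw [Seminorm.mem_ball_zero] at hx ⊢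
    change r⁻¹ * _ < 1 at hx
    rwa [inv_mul_lt_iff₀ hr, mul_one] at hx
  refine ⟨closure ((toCoarsening hs).toLinearMap.rangeRestrict '' U), ?_, subset_closure,
    Set.Subset.rfl⟩
  have hball : (coarseningSeminorm hs ⟨q, hq⟩).ball 0 1 ∈ 𝓝 (0 : coarsening Q hs) :=
    Seminorm.ball_mem_nhds ((withSeminorms_coarsening hs).continuous_seminorm _) one_pos
  refine Filter.mem_of_superset
    (continuous_subtype_val.continuousAt.preimage_mem_nhds hball) fun z hz => ?_
  rw [closure_subtype, ← Set.image_comp]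
  exact closure_mono (Set.image_mono hqU) (supSeminorm_ball_subset_closure hs hQ hq hz)

end Coarsening

theorem ContinuousInverseProperty.continuous_toCoarsening_symm {C : Set (LCS.{u, v} 𝕜)}
    (hC : ContinuousInverseProperty C) (hi : ClosedUnderContinuousImages C) {E : LCS.{u, v} 𝕜}
    (hE : E ∈ C) {Q : Submodule 𝕜 (WeakDual 𝕜 E)} (hQ : NearlyClosed Q)
    (hs : ∀ x ≠ 0, ∃ g ∈ Q, g x ≠ 0) : Continuous (toCoarsening hs).symm := by
  have hinj : Function.Injective (toCoarsening hs).toLinearMap := (toCoarsening hs).injective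
  have hmem := hi E hE _ _ hinj (continuous_toCoarsening hs) (nearlyOpen_toCoarsening hs hQ)
  let e : E ≃ₗ[𝕜] (coarsening Q hs).sub (LinearMap.range (toCoarsening hs).toLinearMap) :=
    LinearEquiv.ofInjective _ hinj
  have he : Continuous e := (continuous_toCoarsening hs).subtype_mk _
  -- The closure property yields the range as a subspace; it is the whole coarsening, and this map
  -- identifies the two.
  have hr : Continuous fun y : coarsening Q hs =>
      (⟨y, (toCoarsening hs).surjective y⟩ : LinearMap.range (toCoarsening hs).toLinearMap) :=
    continuous_id.subtype_mk _
  convert ((hC E hE _ hmem e).1 he).comp hr using 1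
  ext y
  rw [LinearEquiv.symm_apply_eq]
  exact congrArg Subtype.val (e.apply_symm_apply ⟨y, (toCoarsening hs).surjective y⟩).symm

/-- Members of an admissible class are Pták spaces. -/
theorem Admissible.isPtak {C : Set (LCS.{u, v} 𝕜)} (hC : Admissible C) {E : LCS.{u, v} 𝕜}
    (hE : E ∈ C) : E.IsPtak := by
  rw [isPtak_iff]
  intro Q hQ
  -- Dividing by the common kernel of `Q` makes the corresponding functionals separate points, so
  -- that the coarsening is Hausdorff.
  let N : Submodule 𝕜 E :=
    ⨅ g : Q, (WeakDual.toStrongDual (g : WeakDual 𝕜 E)).toLinearMap.ker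
  have hNmem : ∀ x, x ∈ N ↔ ∀ g ∈ Q, g x = 0 := fun x => by
    simp only [N, Submodule.mem_iInf, LinearMap.mem_ker, Subtype.forall]
    rfl
  have hN : IsClosed (N : Set E) := by
    have : (N : Set E) = ⋂ g ∈ Q, {x | g x = 0} := by
      ext x
      simpa using hNmem x
    rw [this]
    exact isClosed_biInter fun g _ => isClosed_eq g.continuous continuous_const
  let π : E →L[𝕜] E.quot N hN := ⟨N.mkQ, N.isOpenQuotientMap_mkQ.continuous⟩
  have hπ : IsQuotientMap π := N.isOpenQuotientMap_mkQ.isQuotientMap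
  have hπ0 : ∀ x, π x = 0 ↔ x ∈ N := fun x => Submodule.Quotient.mk_eq_zero N
  have hQ' := hQ.comap_transpose π
  have hs : ∀ x ≠ 0, ∃ g ∈ Q.comap (transpose π), g x ≠ 0 := by
    intro x hx
    obtain ⟨y, rfl⟩ := hπ.surjective x
    rw [Ne, hπ0, hNmem] at hx
    push Not at hx
    obtain ⟨f, hf, hfy⟩ := hx
    obtain ⟨g, rfl⟩ := exists_transpose_eq hπ (f := f)
      fun x hx => (hNmem x).1 ((hπ0 x).1 hx) f hf
    exact ⟨g, hf, hfy⟩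
  have hc := hC.closedGraphProperty.continuousInverseProperty.continuous_toCoarsening_symm
    hC.images (hC.quotients E hE N hN) hQ' hs
  -- A functional vanishing on `N` descends to the quotient, is continuous for the coarsening
  -- because the two topologies agree, and so comes from `Q`.
  refine isClosed_of_forall_mem fun f hf => ?_
  obtain ⟨g, rfl⟩ := exists_transpose_eq hπ (f := f)
    fun x hx => hf x ((hNmem x).1 ((hπ0 x).1 hx))
  exact mem_of_continuous_coarsening hs hQ' (g.continuous.comp hc)

end LCS

/-- Among all admissible classes of locally convex spaces, the barreled Pták spaces form the
largest one, and in each admissible class all of (O), (C), (G) hold. -/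
theorem mainTheorem1 (𝕜 : Type v) [RCLike 𝕜] :
    IsGreatest {C : Set (LCS.{u, v} 𝕜) | LCS.Admissible C} (LCS.barreledPtak 𝕜) ∧
      ∀ C : Set (LCS.{u, v} 𝕜), LCS.Admissible C →
        LCS.OpenMappingProperty C ∧ LCS.ContinuousInverseProperty C ∧
          LCS.ClosedGraphProperty C := by
  refine ⟨⟨LCS.admissible_barreledPtak, fun C hC E hE => ⟨hC.barrelledSpace hE, hC.isPtak hE⟩⟩,
    fun C hC => ?_⟩
  have hG := hC.closedGraphProperty
  have hI := hG.continuousInverseProperty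
  exact ⟨hI.openMappingProperty hC.quotients, hI, hG⟩
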